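/- All posets carry their Scott topology; a map between posets is \emph{Scott-continuous} if it preserves all existing least upper bounds of non-empty directed families (in particular it is monotone). A \emph{pointed dcpo} is a poset with a least element in which every directed family has a least upper bound. Directed families are non-empty, and maps into a poset are ordered pointwise. For a poset $X$, let $\mathrm{Fin}(X)$ be the set of all upward closures $\uparrow E$ of finite non-empty subsets $E\subseteq X$, ordered by reverse inclusion $\supseteq$. A \emph{quasi-deflation} on $X$ is a Scott-continuous map $\varphi : X\to \mathrm{Fin}(X)$ with finite image such that $x\in\varphi(x)$ for every $x\in X$. A \emph{controlled quasi-deflation} on $X$ is a pair $(f,\varphi)$ of a Scott-continuous map $f:X\to X$ and a quasi-deflation $\varphi$ on $X$ such that $\varphi(x)\subseteq\uparrow f(x)$ for every $x\in X$. A \emph{controlled QRB-domain} is a pointed dcpo $X$ for which there is a family $(f_i,\varphi_i)_{i\in I}$ of controlled quasi-deflations on $X$, directed in the pointwise ordering of pairs, such that $x=\sup_{i\in I} f_i(x)$ for every $x\in X$. An \emph{FS-domain} is a pointed dcpo $X$ for which there is a directed family $(f_i)_{i\in I}$ of Scott-continuous maps $f_i:X\to X$ such that $x=\sup_{i\in I}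 f_i(x)$ for every $x\in X$, and each $f_i$ is finitely separated from the identity: there is a finite set $M_i\subseteq X$ such that for every $x\in X$ there is $m\in M_i$ with $f_i(x)\le m\le x$. \textbf{Theorem.} The controlled QRB-domains are exactly the FS-domains. Hence the category of controlled QRB-domains and Scott-continuous maps is Cartesian-closed. -/

import Mathlib

open CategoryTheory

universe u

/-- `Fin(X)`: the upward closures `↑E` of non-empty finite subsets `E` of `X`.  As a subtype of
`UpperSet X` it is ordered by reverse inclusion. -/
abbrev FinUp (X : Type u) [PartialOrder X] : Type u :=
  {Q : UpperSet X // ∃ E : Set X, E.Finite ∧ E.Nonempty ∧ Q = upperClosure E}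

/-- The underlying subset of `X`. -/
def FinUp.toSet {X : Type u} [PartialOrder X] (Q : FinUp X) : Set X := (Q.1 : Set X)

theorem FinUp.le_iff_toSet {X : Type u} [PartialOrder X] (P Q : FinUp X) :
    P ≤ Q ↔ Q.toSet ⊆ P.toSet := Iff.rfl

/-- A quasi-deflation on a poset `X`. -/
structure IsQuasiDeflation {X : Type u} [PartialOrder X] (φ : X → FinUp X) : Prop where
  scottContinuous : ScottContinuous φ
  self_mem : ∀ x, x ∈ (φ x).toSet
  finite_range : (Set.range φ).Finite

/-- A controlled quasi-deflation `(f, φ)` on a poset `X`, with control `f`. -/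
structure IsControlledQuasiDeflation {X : Type u} [PartialOrder X]
    (f : X → X) (φ : X → FinUp X) : Prop where
  scottContinuous : ScottContinuous f
  isQuasiDeflation : IsQuasiDeflation φ
  subset_Ici : ∀ x, (φ x).toSet ⊆ Set.Ici (f x)

/-- A controlled QRB-domain: a pointed dcpo with a generating (non-empty, directed for the pointwise
ordering of pairs) family of controlled quasi-deflations. `CompletePartialOrder` is Mathlib's class
of pointed dcpos. -/
def IsControlledQRBDomain (X : Type u) [CompletePartialOrder X] : Prop :=
  ∃ (I : Type u) (f : I → X → X) (φ : I → X → FinUp X),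
    Nonempty I ∧
    (∀ i, IsControlledQuasiDeflation (f i) (φ i)) ∧
    Directed (· ≤ ·) (fun i => (f i, φ i)) ∧
    ∀ x, IsLUB (Set.range fun i => f i x) x

/-- `f` is finitely separated from the identity. -/
def FinitelySeparatedFromId {X : Type u} [PartialOrder X] (f : X → X) : Prop :=
  ∃ M : Set X, M.Finite ∧ ∀ x, ∃ m ∈ M, f x ≤ m ∧ m ≤ x

/-- An FS-domain: a pointed dcpo with a (non-empty) directed family of Scott-continuous maps,
finitely separated from the identity, whose pointwise least upper bound is the identity. -/
def IsFSDomain (X : Type u) [CompletePartialOrder X] : Prop :=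
  ∃ (I : Type u) (f : I → X → X),
    Nonempty I ∧
    (∀ i, ScottContinuous (f i)) ∧
    (∀ i, FinitelySeparatedFromId (f i)) ∧
    Directed (· ≤ ·) f ∧
    ∀ x, IsLUB (Set.range fun i => f i x) x

/-- Bundled pointed dcpos. -/
structure PointedDcpo : Type (u + 1) where
  carrier : Type u
  [str : CompletePartialOrder carrier]

attribute [instance] PointedDcpo.str

/-- Scott-continuous maps (not required to preserve the least element). -/
@[ext]
structure PointedDcpo.Hom (X Y : PointedDcpo.{u}) : Type u where
  toFun : X.carrier → Y.carrier
  scottContinuous : ScottContinuous toFun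

/-- The category of pointed dcpos and Scott-continuous maps. -/
instance PointedDcpo.instCategory : Category.{u} PointedDcpo.{u} where
  Hom X Y := PointedDcpo.Hom X Y
  id X := ⟨id, ScottContinuous.id⟩
  comp f g := ⟨g.toFun ∘ f.toFun, f.scottContinuous.comp g.scottContinuous⟩

/-- The property of being a controlled QRB-domain, on objects of `PointedDcpo`. -/
def controlledQRBProperty : ObjectProperty PointedDcpo.{u} :=
  fun X => IsControlledQRBDomain X.carrier

/-- The category of controlled QRB-domains and Scott-continuous maps. -/
abbrev ControlledQRBDomainCat : Type (u + 1) := controlledQRBProperty.{u}.FullSubcategory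

/-- A category is Cartesian-closed: it has finite products (equivalently, some Cartesian monoidal
structure), and every functor `A × -` has a right adjoint. -/
def IsCartesianClosedCategory (C : Type (u + 1)) [Category.{u} C] : Prop :=
  ∃ _ : CartesianMonoidalCategory C, Nonempty (MonoidalClosed C)

/-! If `(f, φ)` is a controlled quasi-deflation, the generators of the finitely many values of `φ`
separate `f` from the identity: `x ∈ φ x` yields a generator `m ≤ x`, and `φ x ⊆ ↑f x` yields `f x ≤
m`. Conversely, if `M` separates `f`, then `x ↦ ↑(M ∩ ↑f x)` is a quasi-deflation controlled by `f`.
The difficulty is directedness of pairs, since the sets `M_i` are unrelated for different `i`.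
Replacing `f_i` by its cube leaves enough room, because `f_i x` is way below `x`.

Cartesian closure then reduces to closure of FS-domains under products and function spaces; for the
latter, `h ↦ g ∘ h ∘ f` applied twice is finitely separated. -/

section Directed

/-- Finitely many conditions, each eventually satisfied along a directed family, are satisfied
simultaneously by some member of the family. -/
theorem Directed.exists_forall_mem_of_finite {I ι α : Type*} [Nonempty I] [Preorder α] {v : I → α}
    (hv : Directed (· ≤ ·) v) {M : Set ι} (hM : M.Finite) {P : ι → I → Prop}
    (hP : ∀ m i j, v i ≤ v j → P m i → P m j) (h : ∀ m ∈ M, ∃ i, P m i) :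
    ∃ i, ∀ m ∈ M, P m i := by
  have := hM.to_subtype
  choose i hi using fun m : M => h m m.2
  obtain ⟨k, hk⟩ := hv.finite_le i
  exact ⟨k, fun m hm => hP _ _ _ (hk ⟨m, hm⟩) (hi ⟨m, hm⟩)⟩

theorem Directed.monotone_comp {I α β : Type*} [Preorder α] [Preorder β] {v : I → α}
    (hv : Directed (· ≤ ·) v) {g : α → β} (hg : Monotone g) : Directed (· ≤ ·) fun i => g (v i) :=
  fun i j => let ⟨k, hi, hj⟩ := hv i j; ⟨k, hg hi, hg hj⟩

theorem Directed.prodMap {I J α β : Type*} [Preorder α] [Preorder β] {v : I → α} {w : J → β}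
    (hv : Directed (· ≤ ·) v) (hw : Directed (· ≤ ·) w) :
    Directed (· ≤ ·) fun p : I × J => (v p.1, w p.2) := by
  rintro ⟨i, j⟩ ⟨i', j'⟩
  obtain ⟨k, hk, hk'⟩ := hv i i'
  obtain ⟨l, hl, hl'⟩ := hw j j'
  exact ⟨(k, l), ⟨hk, hl⟩, ⟨hk', hl'⟩⟩

theorem ScottContinuous.isLUB_range {I α β : Type*} [Nonempty I] [Preorder α] [Preorder β]
    {f : α → β} (hf : ScottContinuous f) {v : I → α} (hv : Directed (· ≤ ·) v) {a : α}
    (ha : IsLUB (Set.range v) a) : IsLUB (Set.range fun i => f (v i)) (f a) := by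
  have := hf (Set.range_nonempty v) hv.directedOn_range ha
  rwa [← Set.range_comp] at this

theorem Directed.apply {I α β : Type*} [Preorder β] {f : I → α → β} (hf : Directed (· ≤ ·) f)
    (x : α) : Directed (· ≤ ·) fun i => f i x :=
  hf.monotone_comp (g := fun h : α → β => h x) (fun _ _ h => h x)

end Directed

/-! ### Approximate identities and finite separation -/

section ApproximateIdentity

variable {X : Type*} [PartialOrder X]

theorem le_of_isLUB_range_id {I : Type*} {f : I → X → X}
    (h : ∀ x, IsLUB (Set.range fun i => f i x) x) (i : I) (x : X) : f i x ≤ x :=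
  (h x).1 ⟨i, rfl⟩

/-- By continuity `f i x` is the supremum of `f i (g j x)` over `j`; joint directedness bounds each
such term by a diagonal one. -/
theorem isLUB_range_comp_self {I : Type*} [Nonempty I] {f g : I → X → X}
    (hf : ∀ i, ScottContinuous (f i)) (hfg : Directed (· ≤ ·) fun i => (f i, g i))
    (hfl : ∀ x, IsLUB (Set.range fun i => f i x) x)
    (hgl : ∀ x, IsLUB (Set.range fun i => g i x) x) (x : X) :
    IsLUB (Set.range fun i => f i (g i x)) x := by
  have hg : Directed (· ≤ ·) g := hfg.monotone_comp monotone_snd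
  refine ⟨?_, fun b hb => (hfl x).2 ?_⟩
  · rintro _ ⟨i, rfl⟩
    exact (le_of_isLUB_range_id hfl i _).trans (le_of_isLUB_range_id hgl i x)
  · rintro _ ⟨i, rfl⟩
    refine ((hf i).isLUB_range (hg.apply x) (hgl x)).2 ?_
    rintro _ ⟨j, rfl⟩
    obtain ⟨k, hik, hjk⟩ := hfg i j
    calc f i (g j x) ≤ f i (g k x) := (hf i).monotone (hjk.2 x)
      _ ≤ f k (g k x) := hik.1 _
      _ ≤ b := hb ⟨k, rfl⟩

/-- Retaining `f` in the pair allows the composition to be iterated, giving squares and cubes. -/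
theorem directed_prodMk_comp_self {I : Type*} {f g : I → X → X}
    (hf : ∀ i, Monotone (f i)) (hfg : Directed (· ≤ ·) fun i => (f i, g i)) :
    Directed (· ≤ ·) fun i => (f i, f i ∘ g i) := by
  intro i j
  obtain ⟨k, hi, hj⟩ := hfg i j
  exact ⟨k, ⟨hi.1, fun x => (hf i (hi.2 x)).trans (hi.1 _)⟩,
    ⟨hj.1, fun x => (hf j (hj.2 x)).trans (hj.1 _)⟩⟩

theorem directed_prodMk_self {I : Type*} {f : I → X → X} (hf : Directed (· ≤ ·) f) :
    Directed (· ≤ ·) fun i => (f i, f i) :=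
  hf.monotone_comp (g := fun h => (h, h)) (fun _ _ h => ⟨h, h⟩)

/-- The values of a map that is finitely separated from the identity are way below their
arguments. -/
theorem FinitelySeparatedFromId.exists_le_of_isLUB {f : X → X} (hs : FinitelySeparatedFromId f)
    (hf : ScottContinuous f) {I : Type*} [Nonempty I] {v : I → X} (hv : Directed (· ≤ ·) v) {x : X}
    (hx : IsLUB (Set.range v) x) : ∃ i, f x ≤ v i := by
  obtain ⟨M, hM, hsep⟩ := hs
  by_contra! hne
  -- If `m` lies above every `f (v i)` and below some `v j`, then `f x ≤ m ≤ v j`. Otherwise each `m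
  -- ∈ M` fails from some index on, so far enough along no `m` separates `f (v i)` from `v i`.
  obtain ⟨i, hi⟩ := hv.exists_forall_mem_of_finite hM
    (P := fun m i => ¬ (f (v i) ≤ m ∧ ∃ j, m ≤ v j))
    (fun m i j hij h h' => h ⟨(hf.monotone hij).trans h'.1, h'.2⟩) (fun m _ => by
      by_contra! hm
      obtain ⟨j, hj⟩ := (hm (Classical.arbitrary I)).2
      refine hne j (((hf.isLUB_range hv hx).2 ?_).trans hj)
      rintro _ ⟨i, rfl⟩
      exact (hm i).1)
  obtain ⟨m, hm, h1, h2⟩ := hsep (v i)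
  exact hi m hm ⟨h1, i, h2⟩

theorem FinitelySeparatedFromId.apply_le {f : X → X} (hf : FinitelySeparatedFromId f) (x : X) :
    f x ≤ x := by
  obtain ⟨M, -, hsep⟩ := hf
  obtain ⟨m, -, h1, h2⟩ := hsep x
  exact h1.trans h2

end ApproximateIdentity

/-! ### Controlled QRB-domains versus FS-domains -/

section ControlledQRB

variable {X : Type u} [PartialOrder X]

/-- The quasi-deflation `x ↦ ↑(M ∩ ↑f(x))` of a map `f` separated from the identity by `M`. -/
def FinUp.ofSeparating (f : X → X) (M : Set X) (hM : M.Finite)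
    (hsep : ∀ x, ∃ m ∈ M, f x ≤ m ∧ m ≤ x) (x : X) : FinUp X :=
  ⟨upperClosure (M ∩ Set.Ici (f x)), M ∩ Set.Ici (f x), hM.inter_of_left _,
    let ⟨m, hm, h, _⟩ := hsep x; ⟨m, hm, h⟩, rfl⟩

theorem FinUp.mem_ofSeparating {f : X → X} {M : Set X} {hM : M.Finite}
    {hsep : ∀ x, ∃ m ∈ M, f x ≤ m ∧ m ≤ x} {x y : X} :
    y ∈ (FinUp.ofSeparating f M hM hsep x).toSet ↔ ∃ m ∈ M, f x ≤ m ∧ m ≤ y := by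
  simp [FinUp.ofSeparating, FinUp.toSet, and_assoc]

theorem isControlledQuasiDeflation_ofSeparating {f : X → X} (hf : ScottContinuous f) {M : Set X}
    (hM : M.Finite) (hsep : ∀ x, ∃ m ∈ M, f x ≤ m ∧ m ≤ x) :
    IsControlledQuasiDeflation f (FinUp.ofSeparating f M hM hsep) where
  scottContinuous := hf
  subset_Ici x y hy := by
    obtain ⟨m, -, h1, h2⟩ := FinUp.mem_ofSeparating.1 hy
    exact h1.trans h2
  isQuasiDeflation :=
    { self_mem := fun x => FinUp.mem_ofSeparating.2 (hsep x)
      finite_range := by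
        refine Set.Finite.of_finite_image (f := Subtype.val)
          ((hM.finite_subsets.image upperClosure).subset ?_) Subtype.val_injective.injOn
        rintro _ ⟨_, ⟨x, rfl⟩, rfl⟩
        exact ⟨M ∩ Set.Ici (f x), Set.inter_subset_left, rfl⟩
      scottContinuous := by
        intro d hd hdir x hx
        have hmono : Monotone (FinUp.ofSeparating f M hM hsep) := fun a b hab => by
          rw [FinUp.le_iff_toSet]
          intro y hy
          obtain ⟨m, hm, h1, h2⟩ := FinUp.mem_ofSeparating.1 hy
          exact FinUp.mem_ofSeparating.2 ⟨m, hm, (hf.monotone hab).trans h1, h2⟩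
        have := hd.to_subtype
        -- As `M` is finite, one `y ∈ d` already refutes every inequality `f x ≤ m` that fails;
        -- hence the quasi-deflation takes the same value at `y` and `x`.
        obtain ⟨⟨y, hy⟩, h⟩ := (directedOn_iff_directed.1 hdir).exists_forall_mem_of_finite hM
          (P := fun m y => f y ≤ m → f x ≤ m)
          (fun m a b hab h hb => h ((hf.monotone hab).trans hb)) (fun m _ => by
            by_contra! hm
            have := hd.some_mem
            refine (hm ⟨_, this⟩).2 ((hf hd hdir hx).2 ?_)
            rintro _ ⟨z, hz, rfl⟩
            exact (hm ⟨z, hz⟩).1)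
        have hyx : FinUp.ofSeparating f M hM hsep x = FinUp.ofSeparating f M hM hsep y := by
          refine le_antisymm ((FinUp.le_iff_toSet _ _).2 fun z hz => ?_) (hmono (hx.1 hy))
          obtain ⟨m, hm, h1, h2⟩ := FinUp.mem_ofSeparating.1 hz
          exact FinUp.mem_ofSeparating.2 ⟨m, hm, h m hm h1, h2⟩
        rw [hyx]
        refine IsGreatest.isLUB ⟨⟨y, hy, rfl⟩, ?_⟩
        rintro _ ⟨z, hz, rfl⟩
        rw [← hyx]
        exact hmono (hx.1 hz) }

/-- The control of a controlled quasi-deflation is finitely separated from the identity. -/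
theorem IsControlledQuasiDeflation.finitelySeparatedFromId {f : X → X} {φ : X → FinUp X}
    (h : IsControlledQuasiDeflation f φ) : FinitelySeparatedFromId f := by
  choose E hE _ hEQ using fun Q : FinUp X => Q.2
  have hmem : ∀ x y, y ∈ (φ x).toSet ↔ ∃ m ∈ E (φ x), m ≤ y := fun x y => by
    rw [FinUp.toSet, hEQ (φ x)]
    exact mem_upperClosure
  refine ⟨⋃ Q ∈ Set.range φ, E Q, h.isQuasiDeflation.finite_range.biUnion fun Q _ => hE Q,
    fun x => ?_⟩
  obtain ⟨m, hm, hmx⟩ := (hmem x x).1 (h.isQuasiDeflation.self_mem x)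
  exact ⟨m, Set.mem_biUnion ⟨x, rfl⟩ hm, h.subset_Ici x ((hmem x m).2 ⟨m, hm, le_rfl⟩), hmx⟩

theorem IsControlledQRBDomain.isFSDomain {X : Type u} [CompletePartialOrder X]
    (h : IsControlledQRBDomain X) : IsFSDomain X := by
  obtain ⟨I, f, φ, hI, hc, hdir, hlub⟩ := h
  exact ⟨I, f, hI, fun i => (hc i).scottContinuous, fun i => (hc i).finitelySeparatedFromId,
    hdir.monotone_comp monotone_fst, hlub⟩

theorem IsFSDomain.isControlledQRBDomain {X : Type u} [CompletePartialOrder X]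
    (h : IsFSDomain X) : IsControlledQRBDomain X := by
  obtain ⟨I, f, hI, hf, hs, hdir, hlub⟩ := h
  have hle := fun i => (hs i).apply_le
  have hmono := fun i => (hf i).monotone
  have hdir₂ := directed_prodMk_comp_self hmono (directed_prodMk_self hdir)
  have hlub₃ := isLUB_range_comp_self (f := f) (g := fun i => f i ∘ f i) hf hdir₂ hlub
    (isLUB_range_comp_self (f := f) (g := f) hf (directed_prodMk_self hdir) hlub hlub)
  have hdir₃ : Directed (· ≤ ·) fun i => f i ∘ f i ∘ f i :=
    (directed_prodMk_comp_self hmono hdir₂).monotone_comp monotone_snd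
  choose M hM hsep using hs
  have hmono₃ : ∀ {i j}, f i ≤ f j → ∀ x, f i (f i (f i x)) ≤ f j (f j (f j x)) := fun {i j} h x =>
    (hmono i ((hmono i (h x)).trans (h _))).trans (h _)
  -- `f i m` is way below `m`, the supremum of the cubes at `m`; one `k` serves all of the finite `M
  -- i`, and any `x` is reached through its separating `m`.
  have key : ∀ i, ∃ k, ∀ x, f i (f i x) ≤ f k (f k (f k x)) := fun i => by
    obtain ⟨k, hk⟩ := hdir.exists_forall_mem_of_finite (hM i)
      (P := fun m k => f i m ≤ f k (f k (f k m))) (fun m k l hkl h => h.trans (hmono₃ hkl m))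
      (fun m _ => FinitelySeparatedFromId.exists_le_of_isLUB ⟨M i, hM i, hsep i⟩ (hf i)
        (hdir₃.apply m) (hlub₃ m))
    refine ⟨k, fun x => ?_⟩
    obtain ⟨m, hm, h1, h2⟩ := hsep i x
    exact (hmono i h1).trans ((hk m hm).trans (hmono k (hmono k (hmono k h2))))
  have hsep₃ : ∀ i x, ∃ m ∈ M i, (f i ∘ f i ∘ f i) x ≤ m ∧ m ≤ x := fun i x => by
    obtain ⟨m, hm, h1, h2⟩ := hsep i x
    exact ⟨m, hm, (hle i _).trans ((hle i _).trans h1), h2⟩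
  -- The third factor `f i` is spent on moving from `m ∈ M k` to some `n ∈ M i` below it: `f i (f i
  -- x) ≤ m` gives `f i (f i (f i x)) ≤ f i m ≤ n ≤ m`.
  have hφ : ∀ {i k}, (∀ x, f i (f i x) ≤ f k (f k (f k x))) →
      FinUp.ofSeparating _ _ (hM i) (hsep₃ i) ≤ FinUp.ofSeparating _ _ (hM k) (hsep₃ k) := by
    intro i k hik x
    rw [FinUp.le_iff_toSet]
    intro y hy
    obtain ⟨m, -, h1, h2⟩ := FinUp.mem_ofSeparating.1 hy
    obtain ⟨n, hn, h3, h4⟩ := hsep i m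
    exact FinUp.mem_ofSeparating.2
      ⟨n, hn, (hmono i ((hik x).trans h1)).trans h3, h4.trans h2⟩
  refine ⟨I, fun i => f i ∘ f i ∘ f i, fun i => FinUp.ofSeparating _ _ (hM i) (hsep₃ i), hI,
    fun i => isControlledQuasiDeflation_ofSeparating (((hf i).comp (hf i)).comp (hf i)) _ _,
    fun i j => ?_, hlub₃⟩
  -- An index above `i` and `j` orders the controls; being above `i'` and `j'` as well, it orders
  -- the quasi-deflations.
  obtain ⟨i', hi'⟩ := key i
  obtain ⟨j', hj'⟩ := key j
  obtain ⟨a, hia, hja⟩ := hdir i j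
  obtain ⟨b, hib, hjb⟩ := hdir i' j'
  obtain ⟨k, hak, hbk⟩ := hdir a b
  exact ⟨k, ⟨hmono₃ (hia.trans hak), hφ fun x => (hi' x).trans (hmono₃ (hib.trans hbk) x)⟩,
    ⟨hmono₃ (hja.trans hak), hφ fun x => (hj' x).trans (hmono₃ (hjb.trans hbk) x)⟩⟩

theorem isControlledQRBDomain_iff_isFSDomain (X : Type u) [CompletePartialOrder X] :
    IsControlledQRBDomain X ↔ IsFSDomain X :=
  ⟨IsControlledQRBDomain.isFSDomain, IsFSDomain.isControlledQRBDomain⟩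

end ControlledQRB

/-! ### Products of FS-domains -/

section Products

instance Prod.instCompletePartialOrder {X Y : Type*} [CompletePartialOrder X]
    [CompletePartialOrder Y] : CompletePartialOrder (X × Y) where
  lubOfDirected _ hd := isLUB_prod.2
    ⟨(DirectedOn.fst hd).isLUB_sSup, (DirectedOn.snd hd).isLUB_sSup⟩

theorem isFSDomain_pUnit : IsFSDomain PUnit.{u + 1} :=
  ⟨PUnit, fun _ => id, inferInstance, fun _ => ScottContinuous.id,
    fun _ => ⟨Set.univ, Set.finite_univ, fun x => ⟨x, trivial, le_rfl, le_rfl⟩⟩,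
    fun i _ => ⟨i, le_rfl, le_rfl⟩, 
    fun _ => ⟨fun _ _ => le_rfl, fun _ _ => le_rfl⟩⟩

theorem FinitelySeparatedFromId.prodMap {X Y : Type*} [PartialOrder X] [PartialOrder Y]
    {f : X → X} {g : Y → Y} (hf : FinitelySeparatedFromId f) (hg : FinitelySeparatedFromId g) :
    FinitelySeparatedFromId (Prod.map f g) := by
  obtain ⟨M, hM, hfM⟩ := hf
  obtain ⟨N, hN, hgN⟩ := hg
  refine ⟨M ×ˢ N, hM.prod hN, fun ⟨x, y⟩ => ?_⟩
  obtain ⟨m, hm, h1, h2⟩ := hfM x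
  obtain ⟨n, hn, h3, h4⟩ := hgN y
  exact ⟨(m, n), ⟨hm, hn⟩, ⟨h1, h3⟩, ⟨h2, h4⟩⟩

theorem IsFSDomain.prod {X Y : Type u} [CompletePartialOrder X] [CompletePartialOrder Y]
    (hX : IsFSDomain X) (hY : IsFSDomain Y) : IsFSDomain (X × Y) := by
  obtain ⟨I, f, hI, hf, hfs, hfd, hfl⟩ := hX
  obtain ⟨J, g, hJ, hg, hgs, hgd, hgl⟩ := hY
  refine ⟨I × J, fun p => Prod.map (f p.1) (g p.2), inferInstance, fun p => (hf p.1).prod (hg p.2),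
    fun p => (hfs p.1).prodMap (hgs p.2),
    (hfd.prodMap hgd).monotone_comp (g := fun q : (X → X) × (Y → Y) => Prod.map q.1 q.2)
      fun _ _ h x => ⟨h.1 x.1, h.2 x.2⟩, fun ⟨x, y⟩ => ?_⟩
  have : (Set.range fun p : I × J => Prod.map (f p.1) (g p.2) (x, y)) =
      (Set.range fun i => f i x) ×ˢ (Set.range fun j => g j y) := by
    ext ⟨a, b⟩
    simp
  rw [this]
  exact (hfl x).prod (Set.range_nonempty _) (Set.range_nonempty _) (hgl y)

end Products

/-! ### Function spaces of FS-domains -/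

namespace PointedDcpo

section FunctionSpace

namespace Hom

variable {X Y : PointedDcpo.{u}}

instance : CoeFun (Hom X Y) fun _ => X.carrier → Y.carrier := ⟨Hom.toFun⟩

/-- Scott-continuous maps are ordered pointwise. -/
instance : PartialOrder (Hom X Y) := PartialOrder.lift Hom.toFun fun _ _ => Hom.ext

theorem directedOn_eval {S : Set (Hom X Y)} (hS : DirectedOn (· ≤ ·) S) (x : X.carrier) :
    DirectedOn (· ≤ ·) ((fun h : Hom X Y => h x) '' S) := by
  rintro _ ⟨h, hh, rfl⟩ _ ⟨k, hk, rfl⟩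
  obtain ⟨l, hl, hhl, hkl⟩ := hS h hh k hk
  exact ⟨_, ⟨l, hl, rfl⟩, hhl x, hkl x⟩

theorem isLUB_of_forall_eval {S : Set (Hom X Y)} {h : Hom X Y}
    (hS : ∀ x, IsLUB ((fun k : Hom X Y => k x) '' S) (h x)) : IsLUB S h :=
  ⟨fun k hk x => (hS x).1 ⟨k, hk, rfl⟩, fun k hk x => (hS x).2 (by
    rintro _ ⟨l, hl, rfl⟩
    exact hk hl x)⟩

/-- Suprema over `S` and over `d` can be interchanged. -/
theorem scottContinuous_sSup {S : Set (Hom X Y)} (hS : DirectedOn (· ≤ ·) S) :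
    ScottContinuous fun x => sSup ((fun h : Hom X Y => h x) '' S) := by
  intro d hd hdir x hx
  refine ⟨?_, fun b hb => (directedOn_eval hS x).sSup_le ?_⟩
  · rintro _ ⟨y, hy, rfl⟩
    refine (directedOn_eval hS y).sSup_le ?_
    rintro _ ⟨h, hh, rfl⟩
    exact (h.scottContinuous.monotone (hx.1 hy)).trans ((directedOn_eval hS x).le_sSup ⟨h, hh, rfl⟩)
  · rintro _ ⟨h, hh, rfl⟩
    refine (h.scottContinuous hd hdir hx).2 ?_
    rintro _ ⟨y, hy, rfl⟩
    exact ((directedOn_eval hS y).le_sSup ⟨h, hh, rfl⟩).trans (hb ⟨y, hy, rfl⟩)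

open Classical in
/-- Directed sets of Scott-continuous maps have pointwise suprema. -/
noncomputable instance : CompletePartialOrder (Hom X Y) :=
  letI : SupSet (Hom X Y) := ⟨fun S => if hS : DirectedOn (· ≤ ·) S then
    ⟨fun x => sSup ((fun h : Hom X Y => h x) '' S), scottContinuous_sSup hS⟩
    -- An arbitrary value for sets that are not directed.
    else ⟨fun _ => ⊥, ScottContinuous.const _⟩⟩
  .ofLubOfDirected _ fun S hS => isLUB_of_forall_eval fun x => by
    have : (sSup S : Hom X Y) x = sSup ((fun h : Hom X Y => h x) '' S) :=
      congrArg (fun h : Hom X Y => h x) (dif_pos hS)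
    rw [this]
    exact (directedOn_eval hS x).isLUB_sSup

theorem scottContinuous_eval (x : X.carrier) : ScottContinuous fun h : Hom X Y => h x := by
  intro S _ hS h hh
  have hl : IsLUB S (⟨_, scottContinuous_sSup hS⟩ : Hom X Y) :=
    isLUB_of_forall_eval fun x => (directedOn_eval hS x).isLUB_sSup
  rw [hh.unique hl]
  exact (directedOn_eval hS x).isLUB_sSup

theorem scottContinuous_of_forall_eval {Z : Type*} [Preorder Z] {F : Z → Hom X Y}
    (hF : ∀ x, ScottContinuous fun z => F z x) : ScottContinuous F := by
  intro d hd hdir z hz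
  refine isLUB_of_forall_eval fun x => ?_
  rw [Set.image_image]
  exact hF x hd hdir hz

/-- The self-map `h ↦ g ∘ h ∘ f` of the function space. -/
def conj (f : Hom X X) (g : Hom Y Y) (h : Hom X Y) : Hom X Y :=
  ⟨fun x => g (h (f x)), (f.scottContinuous.comp h.scottContinuous).comp g.scottContinuous⟩

theorem scottContinuous_conj (f : Hom X X) (g : Hom Y Y) : ScottContinuous (conj f g) :=
  scottContinuous_of_forall_eval fun x => (scottContinuous_eval (f x)).comp g.scottContinuous

theorem conj_mono {f f' : Hom X X} {g g' : Hom Y Y} (hf : f ≤ f') (hg : g ≤ g') :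
    conj f g ≤ conj f' g' := fun h x =>
  (g.scottContinuous.monotone (h.scottContinuous.monotone (hf x))).trans (hg _)

/-- Each `h` determines the finite relation of pairs `(m, n)` of separating elements with
`g (h m) ≤ n ≤ h m`; one representative of each realized relation yields a separating set. -/
theorem finitelySeparatedFromId_conj_conj {f : Hom X X} {g : Hom Y Y}
    (hf : FinitelySeparatedFromId f.toFun) (hg : FinitelySeparatedFromId g.toFun) :
    FinitelySeparatedFromId (conj f g ∘ conj f g) := by
  obtain ⟨M, hM, hfM⟩ := hf
  obtain ⟨N, hN, hgN⟩ := hg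
  let T : Hom X Y → Set (X.carrier × Y.carrier) := fun h =>
    {p ∈ M ×ˢ N | g (h p.1) ≤ p.2 ∧ p.2 ≤ h p.1}
  have hT : (Set.range T).Finite := (hM.prod hN).finite_subsets.subset (by
    rintro _ ⟨h, rfl⟩
    exact Set.sep_subset _ _)
  -- A pair `(m, n)` realized by `h` is realized by `k`, so `n` interpolates between `g (h m)` and
  -- `k m`.
  have key : ∀ h k, T h = T k → conj f g h ≤ k := fun h k hhk x => by
    obtain ⟨m, hm, h1, h2⟩ := hfM x
    obtain ⟨n, hn, h3, h4⟩ := hgN (h m)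
    have : (m, n) ∈ T k := hhk ▸ ⟨⟨hm, hn⟩, h3, h4⟩
    calc g (h (f x)) ≤ g (h m) := g.scottContinuous.monotone (h.scottContinuous.monotone h1)
      _ ≤ n := h3
      _ ≤ k m := this.2.2
      _ ≤ k x := k.scottContinuous.monotone h2
  choose! r hr using fun t (ht : t ∈ Set.range T) => ht
  -- With `r` representing the class of `h`, `key` used in both directions gives `conj f g h ≤ r`
  -- and `conj f g r ≤ h`; applying `conj f g` to the first puts `conj f g r` between the double
  -- conjugate of `h` and `h`. Hence the square.
  refine ⟨(fun t => conj f g (r t)) '' Set.range T, hT.image _, fun h =>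
    ⟨_, ⟨T h, ⟨h, rfl⟩, rfl⟩, ?_, key _ _ (hr _ ⟨h, rfl⟩)⟩⟩
  exact (scottContinuous_conj f g).monotone (key _ _ (hr _ ⟨h, rfl⟩).symm)

end Hom

/-- The exponential of pointed dcpos. -/
noncomputable abbrev exp (X Y : PointedDcpo.{u}) : PointedDcpo.{u} := ⟨Hom X Y⟩

theorem isFSDomain_exp {X Y : PointedDcpo.{u}} (hX : IsFSDomain X.carrier)
    (hY : IsFSDomain Y.carrier) : IsFSDomain (exp X Y).carrier := by
  obtain ⟨I, f, hI, hf, hfs, hfd, hfl⟩ := hX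
  obtain ⟨J, g, hJ, hg, hgs, hgd, hgl⟩ := hY
  let f' : I → Hom X X := fun i => ⟨f i, hf i⟩
  let g' : J → Hom Y Y := fun j => ⟨g j, hg j⟩
  have hfd' : Directed (· ≤ ·) f' := hfd
  have hgd' : Directed (· ≤ ·) g' := hgd
  have hfl₂ := isLUB_range_comp_self hf (directed_prodMk_self hfd) hfl hfl
  have hgl₂ := isLUB_range_comp_self hg (directed_prodMk_self hgd) hgl hgl
  have hmono := fun i => (hf i).monotone
  have hfd₂ : Directed (· ≤ ·) fun i => f i ∘ f i :=
    (directed_prodMk_comp_self hmono (directed_prodMk_self hfd)).monotone_comp monotone_snd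
  refine ⟨I × J, fun p => Hom.conj (f' p.1) (g' p.2) ∘ Hom.conj (f' p.1) (g' p.2), inferInstance,
    fun p => (Hom.scottContinuous_conj _ _).comp (Hom.scottContinuous_conj _ _),
    fun p => Hom.finitelySeparatedFromId_conj_conj (hfs p.1) (hgs p.2), ?_, fun h => ?_⟩
  · exact (hfd'.prodMap hgd').monotone_comp
      (g := fun q : Hom X X × Hom Y Y => Hom.conj q.1 q.2 ∘ Hom.conj q.1 q.2) fun q q' hq h =>
        ((Hom.scottContinuous_conj _ _).monotone (Hom.conj_mono hq.1 hq.2 h)).trans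
          (Hom.conj_mono hq.1 hq.2 _)
  · refine Hom.isLUB_of_forall_eval fun x => ⟨?_, fun b hb => ?_⟩
    · rintro _ ⟨_, ⟨⟨i, j⟩, rfl⟩, rfl⟩
      exact ((hgl₂ _).1 ⟨j, rfl⟩).trans (h.scottContinuous.monotone ((hfl₂ x).1 ⟨i, rfl⟩))
    · refine (h.scottContinuous.isLUB_range (hfd₂.apply x) (hfl₂ x)).2 ?_
      rintro _ ⟨i, rfl⟩
      refine (hgl₂ _).2 ?_
      rintro _ ⟨j, rfl⟩
      exact hb ⟨_, ⟨(i, j), rfl⟩, rfl⟩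

end FunctionSpace

/-- The product of pointed dcpos. -/
abbrev prod (X Y : PointedDcpo.{u}) : PointedDcpo.{u} := ⟨X.carrier × Y.carrier⟩

/-- Scott-continuous maps on a product correspond to Scott-continuous maps into an exponential. -/
def curryEquiv (X Y Z : PointedDcpo.{u}) : Hom (prod X Z) Y ≃ Hom Z (exp X Y) where
  toFun h := ⟨fun z => ⟨fun x => h (x, z),
      (ScottContinuous.id.prodMk (ScottContinuous.const z)).comp h.scottContinuous⟩,
    Hom.scottContinuous_of_forall_eval fun x =>
      ((ScottContinuous.const x).prodMk ScottContinuous.id).comp h.scottContinuous⟩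
  -- Separate Scott continuity in each variable implies joint Scott continuity.
  invFun k := ⟨fun p => (k p.2).toFun p.1, ScottContinuous.fromProd
    (fun x => k.scottContinuous.comp (Hom.scottContinuous_eval x))
    (fun z => (k z).scottContinuous)⟩
  left_inv _ := rfl
  right_inv _ := rfl

end PointedDcpo
-- Cartesian closure of the category
namespace ControlledQRBDomainCat

open Limits MonoidalCategory

/-- Scott-continuous maps as morphisms of controlled QRB-domains. -/
abbrev ofHom {X Y : ControlledQRBDomainCat.{u}} (h : PointedDcpo.Hom X.obj Y.obj) : X ⟶ Y :=
  ObjectProperty.homMk h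

/-- The underlying Scott-continuous map of a morphism. -/
abbrev toHom {X Y : ControlledQRBDomainCat.{u}} (h : X ⟶ Y) : PointedDcpo.Hom X.obj Y.obj :=
  h.hom

theorem isFSDomain (X : ControlledQRBDomainCat.{u}) : IsFSDomain X.obj.carrier :=
  X.property.isFSDomain

/-- The one-point domain. -/
abbrev terminal : ControlledQRBDomainCat.{u} :=
  ⟨⟨PUnit⟩, isFSDomain_pUnit.isControlledQRBDomain⟩

/-- The product domain. -/
abbrev prod (X Y : ControlledQRBDomainCat.{u}) : ControlledQRBDomainCat.{u} :=
  ⟨X.obj.prod Y.obj, (X.isFSDomain.prod Y.isFSDomain).isControlledQRBDomain⟩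

/-- The function space. -/
noncomputable abbrev exp (X Y : ControlledQRBDomainCat.{u}) : ControlledQRBDomainCat.{u} :=
  ⟨X.obj.exp Y.obj,
    (PointedDcpo.isFSDomain_exp X.isFSDomain Y.isFSDomain).isControlledQRBDomain⟩

/-- The one-point domain is terminal. -/
def isTerminal : IsTerminal terminal.{u} :=
  .ofUniqueHom (fun _ => ofHom ⟨fun _ => PUnit.unit, ScottContinuous.const _⟩) fun _ _ => rfl

/-- The projections of the product domain. -/
abbrev prodFan (X Y : ControlledQRBDomainCat.{u}) : BinaryFan X Y :=
  BinaryFan.mk (P := prod X Y) (ofHom ⟨Prod.fst, ScottContinuous.fst⟩)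
    (ofHom ⟨Prod.snd, ScottContinuous.snd⟩)

/-- The product domain is the categorical product. -/
def prodFanIsLimit (X Y : ControlledQRBDomainCat.{u}) : IsLimit (prodFan X Y) :=
  BinaryFan.IsLimit.mk _
    (fun f g => ofHom ⟨fun t => ((toHom f).toFun t, (toHom g).toFun t),
      (toHom f).scottContinuous.prodMk (toHom g).scottContinuous⟩)
    (fun _ _ => rfl) (fun _ _ => rfl) (by rintro T _ _ m rfl rfl; rfl)

/-- The Cartesian structure given by product domains. -/
abbrev cartesianMonoidalCategory : CartesianMonoidalCategory ControlledQRBDomainCat.{u} :=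
  .ofChosenFiniteProducts ⟨asEmptyCone terminal, isTerminal⟩ fun X Y =>
    ⟨prodFan X Y, prodFanIsLimit X Y⟩

attribute [local instance] cartesianMonoidalCategory

/-- Currying as a bijection of hom-sets. -/
noncomputable def curryEquiv (A X Y : ControlledQRBDomainCat.{u}) :
    ((tensorLeft A).obj X ⟶ Y) ≃ (X ⟶ exp A Y) where
  toFun h := ofHom (PointedDcpo.curryEquiv A.obj Y.obj X.obj (toHom h))
  invFun k := ofHom ((PointedDcpo.curryEquiv A.obj Y.obj X.obj).symm (toHom k))
  left_inv _ := rfl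
  right_inv _ := rfl

/-- The category of controlled QRB-domains has exponentials given by function spaces. -/
noncomputable abbrev monoidalClosed : MonoidalClosed ControlledQRBDomainCat.{u} where
  closed A :=
    { rightAdj := _
      adj := Adjunction.adjunctionOfEquivRight (G_obj := exp A) (curryEquiv A)
        fun _ _ _ _ _ => rfl }

theorem isCartesianClosedCategory : IsCartesianClosedCategory.{u} ControlledQRBDomainCat.{u} :=
  ⟨cartesianMonoidalCategory, ⟨monoidalClosed⟩⟩

end ControlledQRBDomainCat

theorem mainTheorem9 :
    (∀ (X : Type u) [CompletePartialOrder X], IsControlledQRBDomain X ↔ IsFSDomain X) ∧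
      IsCartesianClosedCategory.{u} ControlledQRBDomainCat.{u} :=
  ⟨fun X _ => isControlledQRBDomain_iff_isFSDomain X,
    ControlledQRBDomainCat.isCartesianClosedCategory⟩
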